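/- Let $\mathcal H$ be a complex Hilbert space, $\mathscr A=\mathcal B(\mathcal H)$, $\mathscr A_{sa}$ the real Banach space of self-adjoint elements, with Jordan product $\{a,b\}=\tfrac12(ab+ba)$, and let $\mathscr P\subset(\mathscr A_{sa})^*$ be the set of normal positive linear functionals. For $\omega\in\mathscr P$ put $\eta_a(b)=\omega(\{a,b\})$ ($a,b\in\mathscr A_{sa}$) and $J_\omega=\{\eta_a: a\in\mathscr A_{sa}\}$, with inner product $G_\omega(\eta_a,\eta_b)=\omega(\{a,b\})$. Let $\mathcal J_\omega$ be the completion of $(J_\omega,G_\omega)$, identified with a subset of $(\mathscr A_{sa})^*$ through $\eta\mapsto(a\mapsto G_\omega(\eta,\eta_a))$. A smooth parametric model $(\mathcal M,j,\mathscr A)$ is a smooth Banach manifold $\mathcal M$ with a smooth map $j:\mathcal M\to(\mathscr A_{sa})^*$ such that $j(\mathcal M)\subset\mathscr P$. It is J-regular if $T_mj(T_m\mathcal M)\subset\mathcal J_{j(m)}$ for all $m$ and $\mathcal G_m(x,y)=G_{j(m)}(T_mj(x),T_mj(y))$ is a smooth tensor field on $\mathcal M$ (a smooth section of the bundle of continuous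 bilinear forms on the tangent spaces). For $\psi\in\mathcal H$, $|\psi\rangle\langle\psi|$ denotes the functional $a\mapsto\langle\psi,a\psi\rangle$. 1. Let $G$ be a Banach–Lie group, $\pi:G\to\mathcal U(\mathcal H)$ a strongly continuous unitary representation, and $\varphi\in\mathcal H$ a smooth vector, i.e. $g\mapsto\pi(g)\varphi$ is smooth; put $j(g)=|\pi(g)\varphi\rangle\langle\pi(g)\varphi|$. Let $G_\varphi=\{g:\pi(g)\varphi=\varphi\}$ and let $\mathcal M\cong G/G_\varphi$ be a smooth Banach manifold whose projection $p:G\to\mathcal M$ is smooth and has a smooth section $\sigma:\mathcal M\to G$, $p\circ\sigma=\mathrm{id}$. Then $(\mathcal M,j\circ\sigma,\mathcal B(\mathcal H))$ is a J-regular parametric model, every $g\in G$ acts smoothly on $\mathcal M\cong G/G_\varphi$ by left translation, and the tensor field $\mathcal G$ is invariant under this canonical action. 2. Let $\varphi\in\mathcal H$ be nonzero and let $\mathbb{CP}(\mathcal H)$ be the complex projective space of $\mathcal H$ with its standard smooth structure given by affine charts. Then there is a J-regular parametric model $(\mathbb{CP}(\mathcal H),j,\mathcal B(\mathcal H))$ with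 $j([U\varphi])=|U\varphi\rangle\langle U\varphi|$ for every unitary $U$. The unitary group $\mathcal U(\mathcal H)$ acts on $\mathbb{CP}(\mathcal H)$ by diffeomorphisms, and the tensor field $\mathcal G$ of the model is a (positive definite) Riemannian metric that is invariant under this action. -/

import Mathlib

open scoped Manifold ContDiff InnerProductSpace LinearAlgebra.Projectivization

universe u v w

namespace JReg

noncomputable section

section WStar

variable {A : Type u} [CStarAlgebra A]

variable (A) in
/-- The real Banach space `(A_sa)^*` of bounded real functionals on the self-adjoint part. -/
abbrev SADual : Type u := StrongDual ℝ (selfAdjoint A)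

/-- A self-adjoint functional is normal if it is evaluation at a vector of the predual: `A` is
isometrically isomorphic to the dual of a Banach space `X`, and the functional is the image of some
`x : X` under the canonical immersion of `X` in its bidual. (By uniqueness of the predual of a
W*-algebra, the choice of `X` and of the isomorphism is immaterial.) -/
def IsNormal (ρ : SADual A) : Prop :=
  ∃ (X : Type u) (_ : NormedAddCommGroup X) (_ : NormedSpace ℂ X) (_ : CompleteSpace X)
    (e : A ≃ₗᵢ[ℂ] StrongDual ℂ X) (x : X), ∀ a : selfAdjoint A, e (a : A) x = (ρ a : ℂ)

/-- A functional is positive if it is nonnegative on every positive element `b† b`. -/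
def IsPos (ρ : SADual A) : Prop :=
  ∀ b : A, 0 ≤ ρ ⟨star b * b, IsSelfAdjoint.star_mul_self b⟩

variable (A) in
/-- The set of normal positive linear functionals on the W*-algebra `A`. -/
def NPLF : Set (SADual A) := {ρ | IsPos ρ ∧ IsNormal ρ}

/-- The Jordan product `{a, b} = (a b + b a) / 2` on the self-adjoint part. -/
def jordan (a b : selfAdjoint A) : selfAdjoint A :=
  (2⁻¹ : ℝ) • ⟨(a : A) * b + b * a, by
    simp [selfAdjoint.mem_iff, star_add, star_mul, selfAdjoint.star_val_eq, add_comm]⟩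

theorem coe_jordan (a b : selfAdjoint A) :
    (jordan a b : A) = (2⁻¹ : ℝ) • ((a : A) * b + b * a) := rfl

theorem jordan_comm (a b : selfAdjoint A) : jordan a b = jordan b a := by
  apply Subtype.ext
  rw [coe_jordan, coe_jordan, add_comm]

theorem jordan_add_left (a b c : selfAdjoint A) :
    jordan (a + b) c = jordan a c + jordan b c := by
  apply Subtype.ext
  simp only [coe_jordan, AddSubgroup.coe_add, ← smul_add]
  congr 1
  noncomm_ring

theorem jordan_smul_left (r : ℝ) (a c : selfAdjoint A) :
    jordan (r • a) c = r • jordan a c := by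
  apply Subtype.ext
  simp only [coe_jordan, selfAdjoint.val_smul, smul_mul_assoc, mul_smul_comm, ← smul_add]
  rw [smul_comm]

theorem coe_jordan_self (a : selfAdjoint A) : (jordan a a : A) = star (a : A) * a := by
  rw [coe_jordan, selfAdjoint.star_val_eq, ← two_smul ℝ ((a : A) * a), smul_smul]
  norm_num

/-- The space `A_sa` with the semi-inner product `⟪a, b⟫ = ρ({a, b})` (not with the C*-norm).
Modulo null vectors this is `J_ρ` with its inner product `G_ρ(η_a, η_b) = ρ({a, b})`. -/
def PreJ (_ρ : NPLF A) : Type u := selfAdjoint A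

variable (ρ : NPLF A)

instance : AddCommGroup (PreJ ρ) := inferInstanceAs (AddCommGroup (selfAdjoint A))

instance : Module ℝ (PreJ ρ) := inferInstanceAs (Module ℝ (selfAdjoint A))

/-- The semi-inner product `⟪a, b⟫ = ρ({a, b})`. -/
@[reducible]
def preJCore : PreInnerProductSpace.Core ℝ (PreJ ρ) where
  inner a b := ρ.1 (jordan (A := A) a b)
  conj_inner_symm a b := congrArg ρ.1 (jordan_comm (A := A) b a)
  re_inner_nonneg a := by
    have h : jordan (A := A) a a
        = ⟨star ((show selfAdjoint A from a) : A) * (show selfAdjoint A from a),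
            IsSelfAdjoint.star_mul_self _⟩ := Subtype.ext (coe_jordan_self (A := A) a)
    change 0 ≤ ρ.1 (jordan (A := A) a a)
    rw [h]
    exact ρ.2.1 _
  add_left a b c := (congrArg ρ.1 (jordan_add_left (A := A) a b c)).trans (map_add _ _ _)
  smul_left a c r := (congrArg ρ.1 (jordan_smul_left (A := A) r a c)).trans (map_smul _ _ _)

instance : SeminormedAddCommGroup (PreJ ρ) :=
  @InnerProductSpace.Core.toSeminormedAddCommGroup ℝ (PreJ ρ) _ _ _ (preJCore ρ)

instance : InnerProductSpace ℝ (PreJ ρ) := InnerProductSpace.ofCore (preJCore ρ)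

/-- The J-Hilbert space of `ρ`: the completion of `J_ρ` with respect to `G_ρ`. -/
abbrev JHilbert : Type u := UniformSpace.Completion (PreJ ρ)

/-- The linear map sending `a` to the class of `η_a` in the J-Hilbert space. -/
def toJₗ : selfAdjoint A →ₗ[ℝ] JHilbert ρ where
  toFun a := ((show PreJ ρ from a) : JHilbert ρ)
  map_add' a b := UniformSpace.Completion.coe_add (α := PreJ ρ) a b
  map_smul' r a := UniformSpace.Completion.coe_smul (X := PreJ ρ) r a

theorem inner_toJₗ (a b : selfAdjoint A) : ⟪toJₗ ρ a, toJₗ ρ b⟫_ℝ = ρ.1 (jordan a b) :=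
  UniformSpace.Completion.inner_coe (E := PreJ ρ) a b

theorem norm_toJₗ_le (a : selfAdjoint A) : ‖toJₗ ρ a‖ ≤ Real.sqrt ‖ρ.1‖ * ‖a‖ := by
  have h1 : ‖toJₗ ρ a‖ ^ 2 = ρ.1 (jordan a a) := by
    rw [← inner_toJₗ, real_inner_self_eq_norm_sq]
  have h2 : ‖jordan a a‖ ≤ ‖a‖ * ‖a‖ := by
    have : ‖(jordan a a : A)‖ ≤ ‖(a : A)‖ * ‖(a : A)‖ := by
      rw [coe_jordan_self, CStarRing.norm_star_mul_self]
    exact this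
  have h3 : ρ.1 (jordan a a) ≤ ‖ρ.1‖ * (‖a‖ * ‖a‖) :=
    ((le_abs_self _).trans (ρ.1.le_opNorm _)).trans
      (mul_le_mul_of_nonneg_left h2 (norm_nonneg ρ.1))
  refine abs_le_of_sq_le_sq' ?_ (by positivity) |>.2
  rw [h1, mul_pow, Real.sq_sqrt (norm_nonneg ρ.1), pow_two ‖a‖]
  exact h3

/-- The bounded linear map sending `a` to the class of `η_a` in the J-Hilbert space. -/
def toJ : selfAdjoint A →L[ℝ] JHilbert ρ :=
  (toJₗ ρ).mkContinuous (Real.sqrt ‖ρ.1‖) (norm_toJₗ_le ρ)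

/-- The identification of the J-Hilbert space with a set of bounded functionals on `A_sa`: the
vector `η` is identified with the functional `a ↦ G_ρ(η, η_a)`. -/
def jToDual : JHilbert ρ →ₗ[ℝ] SADual A where
  toFun ξ := (innerSL ℝ ξ).comp (toJ ρ)
  map_add' ξ ζ := by ext a; simp
  map_smul' r ξ := by ext a; simp

theorem jToDual_apply (ξ : JHilbert ρ) (a : selfAdjoint A) :
    jToDual ρ ξ a = ⟪ξ, toJ ρ a⟫_ℝ := rfl

/-- The class of `η_a` is identified with the functional `η_a(b) = ρ({a, b})`. -/
theorem jToDual_toJ (a b : selfAdjoint A) : jToDual ρ (toJ ρ a) b = ρ.1 (jordan a b) :=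
  inner_toJₗ ρ a b

theorem jToDual_injective : Function.Injective (jToDual ρ) := by
  rw [injective_iff_map_eq_zero]
  intro ξ h
  have h0 : ∀ a : selfAdjoint A, ⟪ξ, toJ ρ a⟫_ℝ = 0 := fun a => by
    rw [← jToDual_apply, h]; rfl
  have h1 : ∀ ζ : JHilbert ρ, ⟪ξ, ζ⟫_ℝ = 0 := fun ζ =>
    UniformSpace.Completion.induction_on ζ
      (isClosed_eq (continuous_const.inner continuous_id) continuous_const) (fun a => h0 a)
  exact inner_self_eq_zero.mp (h1 ξ)

/-- The J-Hilbert space `𝒥_ρ` as a set of bounded functionals on `A_sa`. -/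
abbrev jSpace : Submodule ℝ (SADual A) := LinearMap.range (jToDual ρ)

/-- The inner product `G_ρ` on `𝒥_ρ`, that is, the extension to the completion of
`G_ρ(η_a, η_b) = ρ({a, b})`. -/
def jInner (η ζ : jSpace ρ) : ℝ :=
  ⟪(LinearEquiv.ofInjective (jToDual ρ) (jToDual_injective ρ)).symm η,
    (LinearEquiv.ofInjective (jToDual ρ) (jToDual_injective ρ)).symm ζ⟫_ℝ

/-- On `J_ρ` the inner product is `G_ρ(η_a, η_b) = ρ({a, b})`. -/
theorem jInner_toJ (a b : selfAdjoint A) :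
    jInner ρ ⟨jToDual ρ (toJ ρ a), LinearMap.mem_range_self _ _⟩
      ⟨jToDual ρ (toJ ρ b), LinearMap.mem_range_self _ _⟩ = ρ.1 (jordan a b) := by
  have h : ∀ ξ : JHilbert ρ, (LinearEquiv.ofInjective (jToDual ρ) (jToDual_injective ρ)).symm
      ⟨jToDual ρ ξ, LinearMap.mem_range_self _ _⟩ = ξ := fun ξ => by
    rw [LinearEquiv.symm_apply_eq]; rfl
  rw [jInner, h, h]
  exact inner_toJₗ ρ a b

end WStar

section Models

variable (E : Type v) [NormedAddCommGroup E] [NormedSpace ℝ E]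
  (M : Type w) [TopologicalSpace M] [ChartedSpace E M]
  (A : Type u) [CStarAlgebra A]

/-- A smooth parametric model of normal positive linear functionals: a smooth map from a manifold
`M` modelled on the Banach space `E` to `(A_sa)^*` with values in the set of normal positive linear
functionals. -/
structure ParametricModel where
  /-- The parametrization. -/
  toFun : M → SADual A
  smooth : ContMDiff 𝓘(ℝ, E) 𝓘(ℝ, SADual A) ∞ toFun
  mem_nplf : ∀ m, toFun m ∈ NPLF A

variable {E M A}

namespace ParametricModel

/-- The normal positive linear functional at the parameter `m`. -/
def point (P : ParametricModel E M A) (m : M) : NPLF A := ⟨P.toFun m, P.mem_nplf m⟩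

/-- The image of a tangent vector under the tangent map of the parametrization. -/
def tangent (P : ParametricModel E M A) (m : M) (x : TangentSpace 𝓘(ℝ, E) m) : SADual A :=
  mfderiv 𝓘(ℝ, E) 𝓘(ℝ, SADual A) P.toFun m x

/-- Tangent vectors of the model lie in the J-Hilbert spaces, so that `metric` makes sense. -/
def HasJTangents (P : ParametricModel E M A) : Prop :=
  ∀ (m : M) (x : TangentSpace 𝓘(ℝ, E) m), P.tangent m x ∈ jSpace (P.point m)

/-- The tensor `𝒢_m(x, y) = G_{j(m)}(T_m j (x), T_m j (y))`. -/
def metric (P : ParametricModel E M A) (hP : P.HasJTangents) (m : M)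
    (x y : TangentSpace 𝓘(ℝ, E) m) : ℝ :=
  jInner (P.point m) ⟨P.tangent m x, hP m x⟩ ⟨P.tangent m y, hP m y⟩

/-- The model is J-regular: `metric` is defined and is a smooth tensor field, i.e. a smooth section
of the bundle of continuous bilinear forms on the tangent spaces of `M`. -/
structure IsJRegular [IsManifold 𝓘(ℝ, E) ∞ M] (P : ParametricModel E M A) : Prop where
  hasJTangents : P.HasJTangents
  smooth_metric :
    ∃ g : ∀ m : M, TangentSpace 𝓘(ℝ, E) m →L[ℝ] TangentSpace 𝓘(ℝ, E) m →L[ℝ] ℝ,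
      (∀ m x y, g m x y = P.metric hasJTangents m x y) ∧
      ContMDiff 𝓘(ℝ, E) (𝓘(ℝ, E).prod 𝓘(ℝ, E →L[ℝ] E →L[ℝ] ℝ)) ∞
        (fun m => Bundle.TotalSpace.mk' (E →L[ℝ] E →L[ℝ] ℝ)
          (E := fun m : M => TangentSpace 𝓘(ℝ, E) m →L[ℝ] TangentSpace 𝓘(ℝ, E) m →L[ℝ] ℝ)
          m (g m))

/-- Invariance of the tensor `metric` under a self-map `f` of `M`: its pull-back along `f` is
itself. -/
def IsInvariantUnder (P : ParametricModel E M A) (hP : P.HasJTangents) (f : M → M) : Prop :=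
  ∀ (m : M) (x y : TangentSpace 𝓘(ℝ, E) m),
    P.metric hP (f m) (mfderiv 𝓘(ℝ, E) 𝓘(ℝ, E) f m x) (mfderiv 𝓘(ℝ, E) 𝓘(ℝ, E) f m y)
      = P.metric hP m x y

end ParametricModel

end Models

section RankOne

variable {H : Type u} [NormedAddCommGroup H] [InnerProductSpace ℂ H] [CompleteSpace H]

/-- The functional `|ψ⟩⟨ψ|` on the self-adjoint part of `B(H)`, that is,
`a ↦ Tr(|ψ⟩⟨ψ| a) = ⟨ψ | a ψ⟩` (which is real as `a` is self-adjoint). -/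
def rankOne (ψ : H) : SADual (H →L[ℂ] H) :=
  LinearMap.mkContinuous
    { toFun := fun a => (⟪ψ, (a : H →L[ℂ] H) ψ⟫_ℂ).re
      map_add' := fun a b => by simp
      map_smul' := fun r a => by
        have : (((r • a : selfAdjoint (H →L[ℂ] H)) : H →L[ℂ] H)) ψ
            = (r : ℂ) • ((a : H →L[ℂ] H) ψ) := by simp
        rw [this, inner_smul_right]
        simp }
    (‖ψ‖ * ‖ψ‖) (fun a => by
      have h1 := Complex.abs_re_le_norm (⟪ψ, (a : H →L[ℂ] H) ψ⟫_ℂ)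
      have h2 := norm_inner_le_norm (𝕜 := ℂ) ψ ((a : H →L[ℂ] H) ψ)
      have h3 := mul_le_mul_of_nonneg_left ((a : H →L[ℂ] H).le_opNorm ψ) (norm_nonneg ψ)
      have h4 : ‖ψ‖ * (‖(a : H →L[ℂ] H)‖ * ‖ψ‖) = ‖ψ‖ * ‖ψ‖ * ‖(a : H →L[ℂ] H)‖ := by ring
      exact (h1.trans (h2.trans h3)).trans h4.le)

variable {G : Type v} [Group G]

/-- The isotropy subgroup `{g | π(g) φ = φ}` of the vector `φ`. -/
def isotropy (π : G →* unitary (H →L[ℂ] H)) (φ : H) : Subgroup G where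
  carrier := {g | (π g : H →L[ℂ] H) φ = φ}
  one_mem' := by simp
  mul_mem' := fun {a b} ha hb => by
    simp only [Set.mem_ofPred_eq] at *
    simp [hb, ha]
  inv_mem' := fun {a} ha => by
    simp only [Set.mem_ofPred_eq] at *
    conv_lhs => rw [← ha]
    rw [← mul_apply_eq_comp, ← Submonoid.coe_mul, ← map_mul]
    simp

end RankOne

section Projective

variable (H : Type u) [NormedAddCommGroup H] [InnerProductSpace ℂ H] [Nontrivial H]

/-- A reference unit vector. -/
def refVec : H := (exists_norm_eq H zero_le_one).choose

theorem norm_refVec : ‖refVec H‖ = 1 := (exists_norm_eq H zero_le_one).choose_spec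

/-- The model space of the projective space: the orthogonal complement of the reference vector. -/
abbrev CPModel : Type u := (ℂ ∙ refVec H)ᗮ

variable {H}

theorem inner_refVec_refVec : ⟪refVec H, refVec H⟫_ℂ = 1 := by
  rw [inner_self_eq_norm_sq_to_K, norm_refVec]; simp

theorem inner_refVec_coe (x : CPModel H) : ⟪refVec H, (x : H)⟫_ℂ = 0 :=
  Submodule.mem_orthogonal_singleton_iff_inner_right.mp x.2

theorem inner_refVec_add (x : CPModel H) : ⟪refVec H, refVec H + (x : H)⟫_ℂ = 1 := by
  rw [inner_add_right, inner_refVec_refVec, inner_refVec_coe, add_zero]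

theorem refVec_add_ne_zero (x : CPModel H) : refVec H + (x : H) ≠ 0 := fun h => by
  have := inner_refVec_add x
  rw [h, inner_zero_right] at this
  exact zero_ne_one this

/-- The affine coordinate of a vector: the component of `⟨e, v⟩⁻¹ v` orthogonal to the reference
vector `e`. -/
def affCoord (v : H) : CPModel H :=
  (ℂ ∙ refVec H)ᗮ.orthogonalProjectionOnto ((⟪refVec H, v⟫_ℂ)⁻¹ • v)

theorem coe_affCoord {v : H} (hv : ⟪refVec H, v⟫_ℂ ≠ 0) :
    (affCoord v : H) = (⟪refVec H, v⟫_ℂ)⁻¹ • v - refVec H := by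
  have hmem : (⟪refVec H, v⟫_ℂ)⁻¹ • v - refVec H ∈ (ℂ ∙ refVec H)ᗮ := by
    rw [Submodule.mem_orthogonal_singleton_iff_inner_right, inner_sub_right, inner_smul_right,
      inv_mul_cancel₀ hv, inner_refVec_refVec, sub_self]
  have hv' : (⟪refVec H, v⟫_ℂ)⁻¹ • v = ((⟪refVec H, v⟫_ℂ)⁻¹ • v - refVec H) + refVec H := by
    abel
  have h1 : (ℂ ∙ refVec H)ᗮ.orthogonalProjectionOnto (refVec H) = 0 :=
    Submodule.orthogonalProjectionOnto_orthogonal_apply_eq_zero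
      (Submodule.mem_span_singleton_self _)
  rw [affCoord, hv', map_add, h1, add_zero, add_sub_cancel_right]
  exact congrArg Subtype.val
    (Submodule.orthogonalProjectionOnto_mem_subspace_eq_self
      (⟨_, hmem⟩ : ((ℂ ∙ refVec H)ᗮ : Submodule ℂ H)))

theorem affCoord_smul (c : ℂ) (hc : c ≠ 0) (v : H) : affCoord (c • v) = affCoord v := by
  rw [affCoord, affCoord, inner_smul_right, smul_smul, mul_inv_rev, mul_assoc,
    inv_mul_cancel₀ hc, mul_one]

theorem affCoord_refVec_add (x : CPModel H) : affCoord (refVec H + (x : H)) = x := by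
  apply Subtype.ext
  rw [coe_affCoord (by rw [inner_refVec_add]; exact one_ne_zero), inner_refVec_add]
  simp

/-- The standard affine chart `[v] ↦ ⟨e, v⟩⁻¹ v - e` of the projective space, defined on the lines
that are not orthogonal to the reference vector `e`. -/
def affChart : PartialEquiv (ℙ ℂ H) (CPModel H) where
  toFun p := affCoord p.rep
  invFun x := Projectivization.mk ℂ (refVec H + (x : H)) (refVec_add_ne_zero x)
  source := {p | ⟪refVec H, p.rep⟫_ℂ ≠ 0}
  target := Set.univ
  map_source' _ _ := Set.mem_univ _
  map_target' x _ := by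
    obtain ⟨a, ha⟩ := Projectivization.exists_smul_eq_mk_rep ℂ _ (refVec_add_ne_zero x)
    change ⟪refVec H, _⟫_ℂ ≠ 0
    rw [← ha, Units.smul_def, inner_smul_right, inner_refVec_add, mul_one]
    exact a.ne_zero
  left_inv' p hp := by
    rw [← p.mk_rep, Projectivization.mk_eq_mk_iff']
    simp only [Projectivization.mk_rep]
    exact ⟨(⟪refVec H, p.rep⟫_ℂ)⁻¹, by rw [coe_affCoord hp]; abel⟩
  right_inv' x _ := by
    obtain ⟨a, ha⟩ := Projectivization.exists_smul_eq_mk_rep ℂ _ (refVec_add_ne_zero x)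
    rw [← ha, Units.smul_def, affCoord_smul _ a.ne_zero, affCoord_refVec_add]

theorem mk_mem_affChart_source (v : H) (hv : v ≠ 0) :
    Projectivization.mk ℂ v hv ∈ (affChart (H := H)).source ↔ ⟪refVec H, v⟫_ℂ ≠ 0 := by
  obtain ⟨a, ha⟩ := Projectivization.exists_smul_eq_mk_rep ℂ v hv
  change ⟪refVec H, _⟫_ℂ ≠ 0 ↔ _
  rw [← ha, Units.smul_def, inner_smul_right]
  simp

theorem affChart_mk (v : H) (hv : v ≠ 0) :
    affChart (Projectivization.mk ℂ v hv) = affCoord v := by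
  obtain ⟨a, ha⟩ := Projectivization.exists_smul_eq_mk_rep ℂ v hv
  change affCoord _ = _
  rw [← ha, Units.smul_def, affCoord_smul _ a.ne_zero]

variable [CompleteSpace H]

/-- The affine chart transported by the unitary operator `U`. -/
def uChart (U : unitary (H →L[ℂ] H)) : PartialEquiv (ℙ ℂ H) (CPModel H) :=
  (MulAction.toPerm U⁻¹).toPartialEquiv.trans affChart

theorem uChart_source (U : unitary (H →L[ℂ] H)) :
    (uChart U).source = {p | U⁻¹ • p ∈ (affChart (H := H)).source} := by
  ext p; simp [uChart]

theorem uChart_apply (U : unitary (H →L[ℂ] H)) (p : ℙ ℂ H) : uChart U p = affChart (U⁻¹ • p) :=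
  rfl

theorem uChart_symm_apply (U : unitary (H →L[ℂ] H)) (x : CPModel H) :
    (uChart U).symm x = U • Projectivization.mk ℂ (refVec H + (x : H)) (refVec_add_ne_zero x) := by
  change (MulAction.toPerm U⁻¹).symm _ = _
  rw [Equiv.symm_apply_eq]
  simp [affChart]

theorem uChart_target (U : unitary (H →L[ℂ] H)) : (uChart U).target = Set.univ := by
  ext x; simp [uChart, affChart]

theorem trans_source (U V : unitary (H →L[ℂ] H)) :
    ((uChart U).symm.trans (uChart V)).source
      = {x : CPModel H | ⟪refVec H, ((V⁻¹ * U : unitary (H →L[ℂ] H)) : H →L[ℂ] H)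
          (refVec H + (x : H))⟫_ℂ ≠ 0} := by
  ext x
  rw [PartialEquiv.trans_source, PartialEquiv.symm_source, uChart_target, Set.univ_inter,
    Set.mem_preimage, uChart_symm_apply, uChart_source, Set.mem_ofPred_eq, ← mul_smul,
    Projectivization.smul_mk, mk_mem_affChart_source]
  rfl

theorem trans_apply (U V : unitary (H →L[ℂ] H)) (x : CPModel H) :
    ((uChart U).symm.trans (uChart V)) x
      = affCoord (((V⁻¹ * U : unitary (H →L[ℂ] H)) : H →L[ℂ] H) (refVec H + (x : H))) := by
  rw [PartialEquiv.trans_apply, uChart_symm_apply, uChart_apply, ← mul_smul,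
    Projectivization.smul_mk, affChart_mk]
  rfl

theorem trans_contDiffOn (U V : unitary (H →L[ℂ] H)) :
    ContDiffOn ℝ ∞ ((uChart U).symm.trans (uChart V))
      ((uChart U).symm.trans (uChart V)).source := by
  have h : (((uChart U).symm.trans (uChart V) : PartialEquiv (CPModel H) (CPModel H)) :
      CPModel H → CPModel H) = fun x : CPModel H => affCoord
        (((V⁻¹ * U : unitary (H →L[ℂ] H)) : H →L[ℂ] H) (refVec H + (x : H))) :=
    funext fun x => trans_apply U V x
  rw [h, trans_source]
  set W : H →L[ℂ] H := ((V⁻¹ * U : unitary (H →L[ℂ] H)) : H →L[ℂ] H)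
  have h1 : ContDiff ℂ ∞ (fun x : CPModel H => W (refVec H + (x : H))) :=
    W.contDiff.comp (contDiff_const.add (ℂ ∙ refVec H)ᗮ.subtypeL.contDiff)
  have h2 : ContDiff ℂ ∞ (fun x : CPModel H => ⟪refVec H, W (refVec H + (x : H))⟫_ℂ) :=
    (innerSL ℂ (refVec H)).contDiff.comp h1
  have h3 : ContDiffOn ℂ ∞ (fun x : CPModel H => affCoord (W (refVec H + (x : H))))
      {x : CPModel H | ⟪refVec H, W (refVec H + (x : H))⟫_ℂ ≠ 0} :=
    (ℂ ∙ refVec H)ᗮ.orthogonalProjectionOnto.contDiff.comp_contDiffOn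
      ((h2.contDiffOn.inv fun x hx => hx).smul h1.contDiffOn)
  exact h3.restrict_scalars ℝ

theorem trans_source_open (U V : unitary (H →L[ℂ] H)) :
    IsOpen ((uChart U).symm.trans (uChart V)).source := by
  rw [trans_source]
  refine isOpen_ne_fun ?_ continuous_const
  fun_prop

theorem exists_mem_uChart (p : ℙ ℂ H) : ∃ U : unitary (H →L[ℂ] H), p ∈ (uChart U).source := by
  by_cases hp : ⟪refVec H, p.rep⟫_ℂ = 0
  · let w : H := refVec H + p.rep
    let R : unitary (H →L[ℂ] H) := Unitary.linearIsometryEquiv.symm (ℂ ∙ w).reflection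
    refine ⟨R⁻¹, ?_⟩
    have hsmul : R • p = Projectivization.mk ℂ (R • p.rep)
        ((smul_ne_zero_iff_ne R).mpr p.rep_nonzero) := by
      conv_lhs => rw [← p.mk_rep]
      exact Projectivization.smul_mk R p.rep_nonzero
    rw [uChart_source, Set.mem_ofPred_eq, inv_inv, hsmul, mk_mem_affChart_source]
    have hR : R • p.rep = (ℂ ∙ w).reflection p.rep := rfl
    have hew : ⟪refVec H, w⟫_ℂ = 1 := by
      rw [inner_add_right, inner_refVec_refVec, hp, add_zero]
    have hpe : ⟪p.rep, refVec H⟫_ℂ = 0 := inner_eq_zero_symm.mp hp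
    have hwp : ⟪w, p.rep⟫_ℂ ≠ 0 := by
      rw [inner_add_left, hp, zero_add]
      exact inner_self_ne_zero.mpr p.rep_nonzero
    have hw : w ≠ 0 := fun h => by simp [h] at hew
    rw [hR, Submodule.reflection_apply, Submodule.starProjection_singleton, inner_sub_right, hp,
      sub_zero, two_nsmul, inner_add_right, inner_smul_right, hew, mul_one, ← two_mul]
    exact mul_ne_zero two_ne_zero
      (div_ne_zero hwp (Complex.ofReal_ne_zero.mpr (pow_ne_zero 2 (norm_ne_zero_iff.mpr hw))))
  · refine ⟨1, ?_⟩
    rw [uChart_source, Set.mem_ofPred_eq, inv_one, one_smul]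
    exact hp

/-- The atlas of affine charts of the complex projective space of `H`. -/
def cpCore : ChartedSpaceCore (CPModel H) (ℙ ℂ H) where
  atlas := Set.range uChart
  chartAt p := uChart (exists_mem_uChart p).choose
  mem_chart_source p := (exists_mem_uChart p).choose_spec
  chart_mem_atlas _ := Set.mem_range_self _
  open_source := by
    rintro _ _ ⟨U, rfl⟩ ⟨V, rfl⟩
    exact trans_source_open U V
  continuousOn_toFun := by
    rintro _ _ ⟨U, rfl⟩ ⟨V, rfl⟩
    exact (trans_contDiffOn U V).continuousOn

instance : TopologicalSpace (ℙ ℂ H) := cpCore.toTopologicalSpace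

instance : ChartedSpace (CPModel H) (ℙ ℂ H) := cpCore.toChartedSpace

/-- The complex projective space of `H`, as a real manifold. -/
instance : IsManifold 𝓘(ℝ, CPModel H) ∞ (ℙ ℂ H) := by
  apply isManifold_of_contDiffOn
  intro e e' he he'
  obtain ⟨_, ⟨U, rfl⟩, rfl⟩ := Set.mem_iUnion₂.mp he
  obtain ⟨_, ⟨V, rfl⟩, rfl⟩ := Set.mem_iUnion₂.mp he'
  exact (trans_contDiffOn U V).mono Set.inter_subset_left

end Projective

end

end JReg

/-! Everything reduces to local vector lifts. Suppose that near each point `j(n) = |ψ(n)⟩⟨ψ(n)|`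
with `ψ` smooth of constant norm `c`. Differentiating along `x`, with `h = dψ(x)`, gives the
functional `a ↦ 2 Re ⟨h, aψ⟩`. As `⟨ψ, aψ⟩` is real for self-adjoint `a`, adding real multiples of
`iψ` to `h` changes nothing, so `h` may be replaced by its component `v` with `⟨ψ, v⟩` real
(`rankOneBilin_horizontal`). For `ψ ≠ 0` such a `v` equals `aψ` for some self-adjoint `a`
(`exists_selfAdjoint_apply_eq`). Since `ω({a, b}) = Re ⟨aψ, bψ⟩` for `ω = |ψ⟩⟨ψ|`, the functional `b
↦ Re ⟨v, bψ⟩` is `η_a`: tangent vectors already lie in `J_ω`, before completion, and `G_ω` becomes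
the real inner product of horizontal vectors.

Thus `𝒢(x, y) = 4 Re ⟨v_x, v_y⟩`, an expression smooth in `ψ` and `dψ` (`isJRegular_of_isLiftAt`),
and unchanged when a unitary carries one lift to another (`isInvariantUnder_of_isLiftAt`).

For an orbit the lift is `m ↦ π(σ m)φ`. For the projective space each affine chart has the lift
given by its normalised affine vector, with `c = ‖φ‖`. Definiteness there says that no nonzero
derivative of this lift is a pure phase rotation.

Normality of `|ψ⟩⟨ψ|` is a separate matter: it requires exhibiting a predual of `B(H)`, here the
norm-closed span of the functionals `a ↦ ⟨x, a y⟩`. -/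

open scoped Topology

namespace JReg

noncomputable section

/-! ### Closed spans of functionals as candidate preduals -/

section DualClosedSpan

variable {A : Type u} [NormedAddCommGroup A] [NormedSpace ℂ A] (S : Set (StrongDual ℂ A))

/-- The closed span of a set of bounded functionals, as a Banach space. -/
def DualClosedSpan : Type u := (Submodule.span ℂ S).topologicalClosure

namespace DualClosedSpan

instance : NormedAddCommGroup (DualClosedSpan S) :=
  inferInstanceAs (NormedAddCommGroup (Submodule.span ℂ S).topologicalClosure)

instance : NormedSpace ℂ (DualClosedSpan S) :=
  inferInstanceAs (NormedSpace ℂ (Submodule.span ℂ S).topologicalClosure)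

instance : CompleteSpace (DualClosedSpan S) :=
  (Submodule.span ℂ S).isClosed_topologicalClosure.completeSpace_coe

/-- The inclusion of the closed span in the dual. -/
def incl : DualClosedSpan S →ₗᵢ[ℂ] StrongDual ℂ A :=
  (Submodule.span ℂ S).topologicalClosure.subtypeₗᵢ

variable {S}

/-- A generator as an element of the closed span. -/
def mk {f : StrongDual ℂ A} (hf : f ∈ S) : DualClosedSpan S :=
  (⟨f, Submodule.le_topologicalClosure _ (Submodule.subset_span hf)⟩ :
    (Submodule.span ℂ S).topologicalClosure)

/-- The generators span a dense subspace of their closed span; density is transported along the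
isometric inclusion `incl`. -/
theorem dual_ext {Φ Ψ : StrongDual ℂ (DualClosedSpan S)}
    (h : ∀ (f : StrongDual ℂ A) (hf : f ∈ S), Φ (mk hf) = Ψ (mk hf)) : Φ = Ψ := by
  have hd : Dense ((Submodule.span ℂ (Set.range fun f : S => mk f.2) :
      Submodule ℂ (DualClosedSpan S)) : Set (DualClosedSpan S)) := by
    intro g
    rw [(incl S).isometry.isUniformInducing.isInducing.closure_eq_preimage_closure_image]
    refine closure_mono ?_ (show incl S g ∈ closure _ from
      (show (Submodule.span ℂ S).topologicalClosure from g).2)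
    change _ ⊆ (incl S).toLinearMap '' _
    rw [← Submodule.map_coe, Submodule.map_span, ← Set.range_comp]
    refine Submodule.span_mono fun f hf => ⟨⟨f, hf⟩, rfl⟩
  refine ContinuousLinearMap.ext_on hd ?_
  rintro _ ⟨f, rfl⟩
  exact h f.1 f.2

variable (S)

/-- Evaluation of the elements of the closed span at a vector. -/
def eval : A →ₗ[ℂ] StrongDual ℂ (DualClosedSpan S) where
  toFun a := (NormedSpace.inclusionInDoubleDual ℂ A a).comp (incl S).toContinuousLinearMap
  map_add' a b := by ext; simp
  map_smul' c a := by ext; simp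

theorem eval_apply (a : A) (f : DualClosedSpan S) : eval S a f = incl S f a := rfl

theorem norm_eval_le (a : A) : ‖eval S a‖ ≤ ‖a‖ := by
  refine ContinuousLinearMap.opNorm_le_bound _ (norm_nonneg a) fun f => ?_
  rw [eval_apply, mul_comm, ← (incl S).norm_map f]
  exact (incl S f).le_opNorm a

end DualClosedSpan

end DualClosedSpan

/-! ### The predual of `B(H)` and normality of vector functionals -/

section Predual

variable {H : Type u} [NormedAddCommGroup H] [InnerProductSpace ℂ H]

/-- The functional `a ↦ ⟨x, a y⟩` on `B(H)`. -/
def vecFunctional (x y : H) : StrongDual ℂ (H →L[ℂ] H) :=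
  (innerSL ℂ x).comp (ContinuousLinearMap.apply ℂ H y)

@[simp]
theorem vecFunctional_apply (x y : H) (a : H →L[ℂ] H) : vecFunctional x y a = ⟪x, a y⟫_ℂ := rfl

theorem norm_vecFunctional_le (x y : H) : ‖vecFunctional x y‖ ≤ ‖x‖ * ‖y‖ := by
  refine ContinuousLinearMap.opNorm_le_bound _ (by positivity) fun a => ?_
  calc ‖⟪x, a y⟫_ℂ‖ ≤ ‖x‖ * ‖a y‖ := norm_inner_le_norm _ _
    _ ≤ ‖x‖ * (‖a‖ * ‖y‖) := by gcongr; exact a.le_opNorm y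
    _ = ‖x‖ * ‖y‖ * ‖a‖ := by ring

variable (H) in
/-- The predual of `B(H)`: the closed span of the functionals `a ↦ ⟨x, a y⟩`. -/
abbrev Predual : Type u :=
  DualClosedSpan (Set.range fun p : H × H => vecFunctional p.1 p.2)

/-- The functional `a ↦ ⟨x, a y⟩` as an element of the predual. -/
def predualVec (x y : H) : Predual H := DualClosedSpan.mk ⟨(x, y), rfl⟩

@[simp]
theorem incl_predualVec (x y : H) :
    DualClosedSpan.incl _ (predualVec x y) = vecFunctional x y := rfl

theorem norm_predualVec_le (x y : H) : ‖predualVec x y‖ ≤ ‖x‖ * ‖y‖ := norm_vecFunctional_le x y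

/-- Evaluation of the elements of the predual at an operator. -/
abbrev predualEval : (H →L[ℂ] H) →ₗ[ℂ] StrongDual ℂ (Predual H) := DualClosedSpan.eval _

theorem predualEval_vec (a : H →L[ℂ] H) (x y : H) :
    predualEval a (predualVec x y) = ⟪x, a y⟫_ℂ := rfl

theorem norm_predualEval (a : H →L[ℂ] H) : ‖predualEval a‖ = ‖a‖ := by
  refine le_antisymm (DualClosedSpan.norm_eval_le _ a) ?_
  · refine ContinuousLinearMap.opNorm_le_bound _ (norm_nonneg _) fun y => ?_
    rcases eq_or_ne (a y) 0 with h0 | h0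
    · rw [h0, norm_zero]; positivity
    · have h1 := (predualEval a).le_opNorm (predualVec (a y) y)
      rw [predualEval_vec, inner_self_eq_norm_sq_to_K, norm_pow, RCLike.norm_ofReal,
        abs_norm] at h1
      have h2 : ‖a y‖ * ‖a y‖ ≤ ‖predualEval a‖ * ‖y‖ * ‖a y‖ := by
        calc ‖a y‖ * ‖a y‖ = ‖a y‖ ^ 2 := (pow_two _).symm
          _ ≤ ‖predualEval a‖ * (‖a y‖ * ‖y‖) := h1.trans
              (mul_le_mul_of_nonneg_left (norm_predualVec_le _ _) (norm_nonneg (predualEval a)))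
          _ = _ := by ring
      exact le_of_mul_le_mul_right h2 (norm_pos_iff.mpr h0)

theorem predual_ext {Φ Ψ : StrongDual ℂ (Predual H)}
    (h : ∀ x y, Φ (predualVec x y) = Ψ (predualVec x y)) : Φ = Ψ := by
  refine DualClosedSpan.dual_ext ?_
  rintro _ ⟨p, rfl⟩
  exact h p.1 p.2

variable [CompleteSpace H]

/-- On generators a functional `Φ` is a bounded sesquilinear form in `(x, y)`, so Riesz
representation supplies an operator `T` with `Φ = ⟨T x, y⟩`; its adjoint is the preimage. -/
theorem predualEval_surjective : Function.Surjective (predualEval (H := H)) := by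
  intro Φ
  let B : H →L⋆[ℂ] H →L[ℂ] ℂ := LinearMap.mkContinuous₂
    (LinearMap.mk₂'ₛₗ (starRingEnd ℂ) (RingHom.id ℂ) (fun x y => Φ (predualVec x y))
      (fun x x' y => by
        rw [← map_add]; congr 1; apply (DualClosedSpan.incl _).injective; ext a; simp)
      (fun c x y => by
        rw [← map_smul]; congr 1; apply (DualClosedSpan.incl _).injective; ext a; simp [mul_comm])
      (fun x y y' => by
        rw [← map_add]; congr 1; apply (DualClosedSpan.incl _).injective; ext a; simp)
      (fun c x y => by
        rw [RingHom.id_apply, ← map_smul]; congr 1; apply (DualClosedSpan.incl _).injective; ext a; simp))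
    ‖Φ‖ (fun x y => by
      rw [mul_assoc]
      exact (Φ.le_opNorm _).trans
        (mul_le_mul_of_nonneg_left (norm_predualVec_le x y) (norm_nonneg Φ)))
  refine ⟨(InnerProductSpace.continuousLinearMapOfBilin B).adjoint, predual_ext fun x y => ?_⟩
  rw [predualEval_vec, ContinuousLinearMap.adjoint_inner_right,
    InnerProductSpace.continuousLinearMapOfBilin_apply]
  rfl

/-- `B(H)` is the dual of its predual. -/
def predualEquiv : (H →L[ℂ] H) ≃ₗᵢ[ℂ] StrongDual ℂ (Predual H) :=
  LinearIsometryEquiv.ofSurjective ⟨predualEval, norm_predualEval⟩ predualEval_surjective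

@[simp]
theorem rankOne_apply (ψ : H) (a : selfAdjoint (H →L[ℂ] H)) :
    rankOne ψ a = (⟪ψ, (a : H →L[ℂ] H) ψ⟫_ℂ).re := rfl

theorem inner_selfAdjoint_comm (a : selfAdjoint (H →L[ℂ] H)) (x y : H) :
    ⟪(a : H →L[ℂ] H) x, y⟫_ℂ = ⟪x, (a : H →L[ℂ] H) y⟫_ℂ :=
  ContinuousLinearMap.isSelfAdjoint_iff_isSymmetric.mp a.2 x y

theorem isPos_rankOne (ψ : H) : IsPos (rankOne ψ) := by
  intro b
  rw [rankOne_apply]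
  change 0 ≤ (⟪ψ, b.adjoint (b ψ)⟫_ℂ).re
  rw [ContinuousLinearMap.adjoint_inner_right]
  exact inner_self_nonneg (𝕜 := ℂ)

theorem isNormal_rankOne (ψ : H) : IsNormal (rankOne ψ) := by
  refine ⟨Predual H, inferInstance, inferInstance, inferInstance, predualEquiv,
    predualVec ψ ψ, fun a => ?_⟩
  change ⟪ψ, (a : H →L[ℂ] H) ψ⟫_ℂ = _
  rw [rankOne_apply, eq_comm, ← Complex.conj_eq_iff_re, inner_conj_symm, inner_selfAdjoint_comm]

theorem rankOne_mem_NPLF (ψ : H) : rankOne ψ ∈ NPLF (H →L[ℂ] H) :=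
  ⟨isPos_rankOne ψ, isNormal_rankOne ψ⟩

end Predual

instance {A : Type u} [CStarAlgebra A] : NormedAddCommGroup (SADual A) := inferInstance

instance {A : Type u} [CStarAlgebra A] : NormedSpace ℝ (SADual A) := inferInstance

/-! ### Derivative of `ψ ↦ |ψ⟩⟨ψ|` and its J-Hilbert representative -/

section RankOneCalculus

variable {H : Type u} [NormedAddCommGroup H] [InnerProductSpace ℂ H]

/-- The real part of the inner product as a bounded real bilinear map. -/
def reInner : H →L[ℝ] H →L[ℝ] ℝ :=
  LinearMap.mkContinuous₂
    (LinearMap.mk₂ ℝ (fun x y : H => (⟪x, y⟫_ℂ).re)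
      (fun x x' y => by simp)
      (fun c x y => by rw [← Complex.coe_smul, inner_smul_left]; simp)
      (fun x y y' => by simp)
      (fun c x y => by rw [← Complex.coe_smul, inner_smul_right]; simp))
    1 (fun x y => by
      rw [one_mul]
      exact (Complex.abs_re_le_norm _).trans (norm_inner_le_norm x y))

@[simp]
theorem reInner_apply (x y : H) : reInner x y = (⟪x, y⟫_ℂ).re := rfl

/-- The component of `h` in the real subspace `{v | ⟨ψ, v⟩ ∈ ℝ}`, where `c` is the norm of `ψ`. -/
def horizontal (c : ℝ) (ψ h : H) : H := h - ((c ^ 2)⁻¹ * (⟪ψ, h⟫_ℂ).im) • (Complex.I • ψ)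

theorem reInner_I_smul (ψ h : H) : reInner (Complex.I • ψ) h = (⟪ψ, h⟫_ℂ).im := by
  simp

/-- The projection on the real subspace `{v | ⟨ψ, v⟩ ∈ ℝ}`, as a bounded operator depending on
`ψ`. -/
def horizontalL (c : ℝ) (ψ : H) : H →L[ℝ] H :=
  ContinuousLinearMap.id ℝ H -
    (c ^ 2)⁻¹ • (reInner (Complex.I • ψ)).smulRight (Complex.I • ψ)

theorem horizontalL_apply (c : ℝ) (ψ h : H) : horizontalL c ψ h = horizontal c ψ h := by
  simp only [horizontalL, horizontal, sub_apply, ContinuousLinearMap.id_apply,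
    smul_apply, ContinuousLinearMap.smulRight_apply, reInner_I_smul, smul_smul]

/-- With the constant `c` in place of `‖ψ‖` the operator is a polynomial in `ψ`, so `ψ = 0` needs no
exception. -/
theorem contDiff_horizontalL (c : ℝ) : ContDiff ℝ ∞ (horizontalL c : H → H →L[ℝ] H) := by
  have h1 : ContDiff ℝ ∞ fun ψ : H => Complex.I • ψ := contDiff_id.const_smul Complex.I
  have h2 : ContDiff ℝ ∞ fun ψ : H => reInner (Complex.I • ψ) :=
    (reInner (H := H)).contDiff.comp h1
  have h3 : ContDiff ℝ ∞ fun ψ : H => (reInner (Complex.I • ψ)).smulRight (Complex.I • ψ) :=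
    h2.smulRight h1
  have h4 : ContDiff ℝ ∞ fun ψ : H =>
      (c ^ 2)⁻¹ • (reInner (Complex.I • ψ)).smulRight (Complex.I • ψ) :=
    contDiff_const.fun_smul h3
  exact contDiff_const.sub h4

theorem im_inner_horizontal {c : ℝ} {ψ : H} (hψ : ‖ψ‖ = c) (h : H) :
    (⟪ψ, horizontal c ψ h⟫_ℂ).im = 0 := by
  have h1 : reInner (Complex.I • ψ) (Complex.I • ψ) = c ^ 2 := by
    rw [reInner_apply, ← hψ, inner_self_eq_norm_sq_to_K, norm_smul, Complex.norm_I, one_mul]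
    exact congrArg Complex.re (Complex.ofReal_pow ‖ψ‖ 2).symm
  rw [← reInner_I_smul, horizontal, (reInner (Complex.I • ψ)).map_sub,
    (reInner (Complex.I • ψ)).map_smul, h1, reInner_I_smul, smul_eq_mul]
  rcases eq_or_ne c 0 with rfl | hc
  · rw [norm_eq_zero.mp hψ]; simp
  · field_simp
    ring

variable [CompleteSpace H]

/-- The functional `a ↦ Re ⟨ψ, a χ⟩`, as a bounded bilinear map. -/
def rankOneBilin : H →L[ℝ] H →L[ℝ] SADual (H →L[ℂ] H) :=
  LinearMap.mkContinuous₂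
    (LinearMap.mk₂ ℝ (fun x y : H => (reInner x).comp
        (((ContinuousLinearMap.apply ℂ H y).restrictScalars ℝ).comp
          (selfAdjoint.submodule ℝ (H →L[ℂ] H)).subtypeL))
      (fun x x' y => by ext; simp)
      (fun c x y => by ext; simp)
      (fun x y y' => by
        ext a
        change reInner x ((a : H →L[ℂ] H) (y + y')) = _
        rw [map_add, map_add]
        rfl)
      (fun c x y => by
        ext a
        change reInner x ((a : H →L[ℂ] H) (c • y)) = _
        rw [← Complex.coe_smul, map_smul, Complex.coe_smul, map_smul]
        rfl))
    1 (fun x y => by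
      refine ContinuousLinearMap.opNorm_le_bound _ (by positivity) fun a => ?_
      refine (Complex.abs_re_le_norm _).trans ((norm_inner_le_norm x _).trans ?_)
      rw [one_mul, mul_assoc, mul_comm ‖y‖]
      exact mul_le_mul_of_nonneg_left ((a : H →L[ℂ] H).le_opNorm y) (norm_nonneg x))

@[simp]
theorem rankOneBilin_apply (x y : H) (a : selfAdjoint (H →L[ℂ] H)) :
    rankOneBilin x y a = (⟪x, (a : H →L[ℂ] H) y⟫_ℂ).re := rfl

theorem rankOneBilin_comm (x y : H) : rankOneBilin x y = rankOneBilin y x := by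
  ext a
  rw [rankOneBilin_apply, rankOneBilin_apply, ← inner_selfAdjoint_comm, ← inner_conj_symm,
    Complex.conj_re]

theorem contDiff_rankOne : ContDiff ℝ ∞ (rankOne : H → SADual (H →L[ℂ] H)) := by
  change ContDiff ℝ ∞ fun ψ : H => rankOneBilin ψ ψ
  exact (rankOneBilin (H := H)).contDiff.clm_apply contDiff_id

/-- The map is the diagonal of a bilinear map that is symmetric because the operators are
self-adjoint, whence the factor 2. -/
theorem hasFDerivAt_rankOne (ψ : H) :
    HasFDerivAt (rankOne : H → SADual (H →L[ℂ] H)) ((2 : ℝ) • rankOneBilin.flip ψ) ψ := by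
  have h := (rankOneBilin (H := H)).hasFDerivAt_of_bilinear (hasFDerivAt_id ψ) (hasFDerivAt_id ψ)
  refine h.congr_fderiv ?_
  ext x : 1
  simp [ContinuousLinearMap.precompR, ContinuousLinearMap.precompL, two_smul,
    rankOneBilin_comm ψ x]

/-- Infinitesimal phase invariance: `⟨ψ, aψ⟩` is real, so the direction `iψ` is annihilated. -/
theorem rankOneBilin_horizontal (c : ℝ) (ψ h : H) :
    rankOneBilin (horizontal c ψ h) ψ = rankOneBilin h ψ := by
  have : rankOneBilin (Complex.I • ψ) ψ = 0 := by
    ext a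
    rw [rankOneBilin_apply, ← reInner_apply, reInner_I_smul, zero_apply,
      ← Complex.conj_eq_iff_im, inner_conj_symm, inner_selfAdjoint_comm]
  rw [horizontal, map_sub, map_smul, sub_apply,
    smul_apply, this, smul_zero, sub_zero]

theorem rankOne_smul (z : ℂ) (ψ : H) : rankOne (z • ψ) = ‖z‖ ^ 2 • rankOne ψ := by
  ext a
  rw [rankOne_apply, map_smul, inner_smul_left, inner_smul_right, ← mul_assoc,
    Complex.conj_mul', ← Complex.ofReal_pow, Complex.re_ofReal_mul]
  rfl

theorem rankOne_jordan (ψ : H) (a b : selfAdjoint (H →L[ℂ] H)) :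
    rankOne ψ (jordan a b) = (⟪(a : H →L[ℂ] H) ψ, (b : H →L[ℂ] H) ψ⟫_ℂ).re := by
  have h : (jordan a b : H →L[ℂ] H) ψ
      = (2⁻¹ : ℝ) • ((a : H →L[ℂ] H) ((b : H →L[ℂ] H) ψ) + (b : H →L[ℂ] H) ((a : H →L[ℂ] H) ψ)) := by
    rw [coe_jordan]; rfl
  have h2 : (⟪(b : H →L[ℂ] H) ψ, (a : H →L[ℂ] H) ψ⟫_ℂ).re =
      (⟪(a : H →L[ℂ] H) ψ, (b : H →L[ℂ] H) ψ⟫_ℂ).re := by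
    rw [← inner_conj_symm, Complex.conj_re]
  rw [rankOne_apply, h, ← reInner_apply, map_smul, map_add, reInner_apply, reInner_apply,
    ← inner_selfAdjoint_comm a ψ, ← inner_selfAdjoint_comm b ψ, h2, smul_eq_mul]
  ring

theorem exists_selfAdjoint_apply_eq {ψ v : H} (hψ : ψ ≠ 0) (hv : (⟪ψ, v⟫_ℂ).im = 0) :
    ∃ a : selfAdjoint (H →L[ℂ] H), (a : H →L[ℂ] H) ψ = v := by
  obtain ⟨r, hr⟩ : ∃ r : ℝ, ⟪ψ, v⟫_ℂ = r := ⟨_, (Complex.ext rfl (by simpa using hv))⟩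
  have hn : ‖ψ‖ ≠ 0 := norm_ne_zero_iff.mpr hψ
  let K := fun x y : H => InnerProductSpace.rankOne ℂ x y
  have hK : ∀ x y, star (K x y) = K y x := fun x y => InnerProductSpace.adjoint_rankOne x y
  -- The term `K v ψ` sends `ψ` to `‖ψ‖² v`. Its adjoint `K ψ v` makes the operator self-adjoint but
  -- adds `r ψ`, which the last term removes; that term is self-adjoint because `r` is real.
  let a : H →L[ℂ] H := (‖ψ‖ ^ 2)⁻¹ • (K v ψ + K ψ v) - (r * ((‖ψ‖ ^ 2)⁻¹) ^ 2) • K ψ ψ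
  have ha : IsSelfAdjoint a := by
    rw [IsSelfAdjoint, star_sub, star_smul, star_smul, star_add, hK, hK, hK, star_trivial,
      star_trivial, add_comm (K ψ v)]
  refine ⟨⟨a, ha⟩, ?_⟩
  have hr' : ⟪v, ψ⟫_ℂ = r := by rw [← inner_conj_symm, hr, Complex.conj_ofReal]
  have hc : ((‖ψ‖ : ℝ) : ℂ) ≠ 0 := Complex.ofReal_ne_zero.mpr hn
  simp only [a, K, sub_apply, smul_apply,
    add_apply, InnerProductSpace.rankOne_apply, hr',
    inner_self_eq_norm_sq_to_K, ← Complex.coe_smul, smul_add, smul_smul, Complex.coe_algebraMap]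
  push_cast
  rw [inv_mul_cancel₀ (pow_ne_zero 2 hc), one_smul, add_sub_assoc, ← sub_smul]
  have : (((‖ψ‖ : ℝ) : ℂ) ^ 2)⁻¹ * (r : ℂ) - r * (((‖ψ‖ : ℂ) ^ 2)⁻¹) ^ 2 * (‖ψ‖ : ℂ) ^ 2 = 0 := by
    field_simp; ring
  rw [this, zero_smul, add_zero]

/-- The functional is `η_a` itself, by `rankOne_jordan`, so no limit in the completion is involved.
-/
theorem exists_jToDual_eq (ρ : NPLF (H →L[ℂ] H)) {ψ v : H} (hρ : ρ.1 = rankOne ψ)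
    (h : ∃ a : selfAdjoint (H →L[ℂ] H), (a : H →L[ℂ] H) ψ = v) :
    ∃ a : selfAdjoint (H →L[ℂ] H), (a : H →L[ℂ] H) ψ = v ∧
      jToDual ρ (toJ ρ a) = rankOneBilin v ψ := by
  obtain ⟨a, rfl⟩ := h
  refine ⟨a, rfl, ?_⟩
  ext b
  rw [jToDual_toJ, hρ, rankOne_jordan, rankOneBilin_apply]

theorem jInner_rankOneBilin (ρ : NPLF (H →L[ℂ] H)) {ψ v w : H} (hρ : ρ.1 = rankOne ψ)
    (hv : ∃ a : selfAdjoint (H →L[ℂ] H), (a : H →L[ℂ] H) ψ = v)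
    (hw : ∃ a : selfAdjoint (H →L[ℂ] H), (a : H →L[ℂ] H) ψ = w)
    (η ζ : jSpace ρ) (hη : (η : SADual (H →L[ℂ] H)) = rankOneBilin v ψ)
    (hζ : (ζ : SADual (H →L[ℂ] H)) = rankOneBilin w ψ) :
    jInner ρ η ζ = (⟪v, w⟫_ℂ).re := by
  obtain ⟨a, ha, ha'⟩ := exists_jToDual_eq ρ hρ hv
  obtain ⟨b, hb, hb'⟩ := exists_jToDual_eq ρ hρ hw
  have h := jInner_toJ ρ a b
  rw [hρ, rankOne_jordan, ha, hb] at h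
  rw [← h]
  congr 1
  · exact Subtype.ext (hη.trans ha'.symm)
  · exact Subtype.ext (hζ.trans hb'.symm)

end RankOneCalculus

/-! ### Smooth dependence of the pulled-back inner product on the operator -/

section BilinearPullback

variable {H : Type u} [NormedAddCommGroup H] [InnerProductSpace ℂ H]
  {E : Type v} [NormedAddCommGroup E] [NormedSpace ℝ E]

/-- The pull-back of the real inner product along a bounded operator. -/
def pullbackInner (V : E →L[ℝ] H) : E →L[ℝ] E →L[ℝ] ℝ := (V.precomp ℝ).comp (reInner.comp V)

theorem pullbackInner_apply (V : E →L[ℝ] H) (x y : E) :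
    pullbackInner V x y = (⟪V x, V y⟫_ℂ).re := rfl

theorem contDiff_pullbackInner :
    ContDiff ℝ ∞ (pullbackInner : (E →L[ℝ] H) → E →L[ℝ] E →L[ℝ] ℝ) := by
  have h1 : ContDiff ℝ ∞ fun V : E →L[ℝ] H => (reInner (H := H)).comp V :=
    contDiff_const.clm_comp contDiff_id
  have h2 : ContDiff ℝ ∞ fun V : E →L[ℝ] H => V.precomp ℝ :=
    contMDiff_iff_contDiff.mp contMDiff_id.clm_precomp
  exact h2.clm_comp h1

end BilinearPullback

/-! ### Bilinear forms and derivatives in tangent bundle coordinates -/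

section BundleCoordinates

open ContinuousLinearMap in
theorem inCoordinates_bilinear_apply {E : Type v} [NormedAddCommGroup E] [NormedSpace ℝ E]
    {M : Type w} [TopologicalSpace M] [ChartedSpace E M] [IsManifold 𝓘(ℝ, E) ∞ M] (m₀ m : M)
    (hm : m ∈ (chartAt E m₀).source)
    (g : TangentSpace 𝓘(ℝ, E) m →L[ℝ] TangentSpace 𝓘(ℝ, E) m →L[ℝ] ℝ) (x y : E) :
    inCoordinates E (TangentSpace 𝓘(ℝ, E) (M := M)) (E →L[ℝ] ℝ)
      (fun m : M => TangentSpace 𝓘(ℝ, E) m →L[ℝ] ℝ) m₀ m m₀ m g x y =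
      g ((trivializationAt E (TangentSpace 𝓘(ℝ, E)) m₀).symmL ℝ m x)
        ((trivializationAt E (TangentSpace 𝓘(ℝ, E)) m₀).symmL ℝ m y) := by
  have hm' : m ∈ (trivializationAt E (TangentSpace 𝓘(ℝ, E)) m₀).baseSet := hm
  refine (inCoordinates_apply_eq₂ (E₃ := Bundle.Trivial M ℝ) hm' hm' (Set.mem_univ m)).trans ?_
  rw [Bundle.Trivialization.symmL_apply _ hm', Bundle.Trivialization.symmL_apply _ hm']
  simp

theorem inTangentCoordinates_apply {E : Type v} [NormedAddCommGroup E] [NormedSpace ℝ E]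
    {F : Type u} [NormedAddCommGroup F] [NormedSpace ℝ F]
    {M : Type w} [TopologicalSpace M] [ChartedSpace E M] [IsManifold 𝓘(ℝ, E) ∞ M] (m₀ m : M)
    (f : M → F) (D : M → E →L[ℝ] F) (x : E) :
    inTangentCoordinates 𝓘(ℝ, E) 𝓘(ℝ, F) id f D m₀ m x =
      D m ((trivializationAt E (TangentSpace 𝓘(ℝ, E)) m₀).symmL ℝ m x) := by
  simp [inTangentCoordinates, ContinuousLinearMap.inCoordinates]
  rfl

end BundleCoordinates

/-! ### Vector lifts: tangent vectors, J-regularity and invariance -/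

section HorizontalDeriv

variable {H : Type u} [NormedAddCommGroup H] [InnerProductSpace ℂ H]
  {E : Type v} [NormedAddCommGroup E] [NormedSpace ℝ E]
  {M : Type w} [TopologicalSpace M] [ChartedSpace E M]

/-- The derivative of a vector-valued map, as an operator on the model space. -/
def modelDeriv (ψ : M → H) (m : M) : E →L[ℝ] H := mfderiv 𝓘(ℝ, E) 𝓘(ℝ, H) ψ m

/-- The vector representing the tangent vector of `|ψ⟩⟨ψ|` in the J-Hilbert space. -/
def horizontalDeriv (c : ℝ) (ψ : M → H) (m : M) : E →L[ℝ] H :=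
  (2 : ℝ) • (horizontalL c (ψ m)).comp (modelDeriv ψ m)

theorem horizontalDeriv_apply (c : ℝ) (ψ : M → H) (m : M) (x : E) :
    horizontalDeriv c ψ m x = (2 : ℝ) • horizontal c (ψ m) (modelDeriv ψ m x) := by
  rw [← horizontalL_apply]; rfl

end HorizontalDeriv

section Lifts

variable {H : Type u} [NormedAddCommGroup H] [InnerProductSpace ℂ H] [CompleteSpace H]
  {E : Type v} [NormedAddCommGroup E] [NormedSpace ℝ E]
  {M : Type w} [TopologicalSpace M] [ChartedSpace E M]

/-- Near `m` the model is `n ↦ |ψ n⟩⟨ψ n|` for a smooth vector-valued map `ψ` of constant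
norm `c`. -/
def ParametricModel.IsLiftAt (P : ParametricModel E M (H →L[ℂ] H)) (c : ℝ) (ψ : M → H) (m : M) :
    Prop :=
  ∀ᶠ n in 𝓝 m, ContMDiffAt 𝓘(ℝ, E) 𝓘(ℝ, H) ∞ ψ n ∧ ‖ψ n‖ = c ∧ P.toFun n = rankOne (ψ n)

theorem horizontal_unitary (c : ℝ) (U : unitary (H →L[ℂ] H)) (ψ h : H) :
    horizontal c ((U : H →L[ℂ] H) ψ) ((U : H →L[ℂ] H) h) = (U : H →L[ℂ] H) (horizontal c ψ h) := by
  rw [horizontal, horizontal, Unitary.inner_map_map, map_sub,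
    (U : H →L[ℂ] H).map_smul_of_tower, map_smul]

namespace ParametricModel.IsLiftAt

variable {P : ParametricModel E M (H →L[ℂ] H)} {c : ℝ} {ψ : M → H} {m : M}

theorem contMDiffAt (h : P.IsLiftAt c ψ m) : ContMDiffAt 𝓘(ℝ, E) 𝓘(ℝ, H) ∞ ψ m :=
  (Filter.Eventually.self_of_nhds h).1

theorem mdifferentiableAt (h : P.IsLiftAt c ψ m) : MDifferentiableAt 𝓘(ℝ, E) 𝓘(ℝ, H) ψ m :=
  h.contMDiffAt.mdifferentiableAt (by simp)

theorem norm_eq (h : P.IsLiftAt c ψ m) : ‖ψ m‖ = c := (Filter.Eventually.self_of_nhds h).2.1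

theorem toFun_eq (h : P.IsLiftAt c ψ m) : P.toFun m = rankOne (ψ m) := (Filter.Eventually.self_of_nhds h).2.2

theorem tangent_eq (h : P.IsLiftAt c ψ m) (x : E) :
    P.tangent m x = rankOneBilin (horizontalDeriv c ψ m x) (ψ m) := by
  have h1 : P.toFun =ᶠ[𝓝 m] rankOne ∘ ψ := h.mono fun n hn => hn.2.2
  have h2 := (hasFDerivAt_rankOne (ψ m)).hasMFDerivAt.comp m h.mdifferentiableAt.hasMFDerivAt
  rw [horizontalDeriv_apply, map_smul, smul_apply, rankOneBilin_horizontal]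
  exact DFunLike.congr_fun (h1.mfderiv_eq.trans h2.mfderiv) x

theorem exists_apply_eq (h : P.IsLiftAt c ψ m) (x : E) :
    ∃ a : selfAdjoint (H →L[ℂ] H), (a : H →L[ℂ] H) (ψ m) = horizontalDeriv c ψ m x := by
  rcases eq_or_ne c 0 with rfl | hc
  -- A lift of norm 0 vanishes near `m`, so its derivative is zero and `a = 0` serves. This covers
  -- orbits of `φ = 0`.
  · refine ⟨0, ?_⟩
    have h1 : ψ =ᶠ[𝓝 m] fun _ => 0 := h.mono fun n hn => norm_eq_zero.mp hn.2.1
    have h2 : modelDeriv (E := E) ψ m = 0 := h1.mfderiv_eq.trans mfderiv_const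
    rw [horizontalDeriv, h2, ContinuousLinearMap.comp_zero, smul_zero]
    rfl
  · refine exists_selfAdjoint_apply_eq (norm_ne_zero_iff.mp (h.norm_eq.trans_ne hc)) ?_
    rw [horizontalDeriv_apply, ← Complex.coe_smul, inner_smul_right, Complex.im_ofReal_mul,
      im_inner_horizontal h.norm_eq, mul_zero]

theorem tangent_mem (h : P.IsLiftAt c ψ m) (x : TangentSpace 𝓘(ℝ, E) m) :
    P.tangent m x ∈ jSpace (P.point m) := by
  obtain ⟨a, -, ha⟩ := exists_jToDual_eq (P.point m) h.toFun_eq (h.exists_apply_eq x)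
  exact ⟨toJ _ a, ha.trans (h.tangent_eq x).symm⟩

theorem metric_eq (h : P.IsLiftAt c ψ m) (hP : P.HasJTangents) (x y : E) :
    P.metric hP m x y = (⟪horizontalDeriv c ψ m x, horizontalDeriv c ψ m y⟫_ℂ).re :=
  jInner_rankOneBilin (P.point m) h.toFun_eq (h.exists_apply_eq x) (h.exists_apply_eq y)
    ⟨P.tangent m x, hP m x⟩ ⟨P.tangent m y, hP m y⟩ (h.tangent_eq x) (h.tangent_eq y)

end ParametricModel.IsLiftAt

namespace ParametricModel

variable {P : ParametricModel E M (H →L[ℂ] H)} {c : ℝ}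

theorem hasJTangents_of_isLiftAt (h : ∀ m, ∃ ψ, P.IsLiftAt c ψ m) : P.HasJTangents := fun m x => by
  obtain ⟨ψ, hψ⟩ := h m
  exact hψ.tangent_mem x

/-- Smoothness is local: near `m₀` the tensor is the pull-back of the inner product along the
horizontal derivative of one fixed lift, a smooth family of operators. -/
theorem isJRegular_of_isLiftAt [IsManifold 𝓘(ℝ, E) ∞ M] (h : ∀ m, ∃ ψ, P.IsLiftAt c ψ m) :
    P.IsJRegular := by
  have hP := hasJTangents_of_isLiftAt h
  refine ⟨hP, ?_⟩
  choose ψ hψ using h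
  refine ⟨fun m => pullbackInner (E := E) (horizontalDeriv c (ψ m) m), fun m x y => ((hψ m).metric_eq hP x y).symm, fun m₀ => ?_⟩
  rw [contMDiffAt_hom_bundle]
  refine ⟨contMDiffAt_id, ?_⟩
  have h1 : ContMDiffAt 𝓘(ℝ, E) 𝓘(ℝ, E →L[ℝ] H) ∞ (fun n => (2 : ℝ) •
      (horizontalL c (ψ m₀ n)).comp (inTangentCoordinates 𝓘(ℝ, E) 𝓘(ℝ, H) id (ψ m₀)
        (modelDeriv (ψ m₀)) m₀ n)) m₀ := by
    have h2 : ContMDiffAt 𝓘(ℝ, E) 𝓘(ℝ, H →L[ℝ] H) ∞ (fun n => horizontalL c (ψ m₀ n)) m₀ :=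
      (contDiff_horizontalL c).contMDiff.contMDiffAt.comp m₀ (hψ m₀).contMDiffAt
    have h3 := (hψ m₀).contMDiffAt.mfderiv_const (m := ∞) (by simp)
    exact ((contDiff_const_smul (2 : ℝ)).contMDiff.contMDiffAt).comp m₀ (h2.clm_comp h3)
  have h4 := (contDiff_pullbackInner (H := H) (E := E)).contMDiff.contMDiffAt.comp m₀ h1
  refine h4.congr_of_eventuallyEq ?_
  filter_upwards [(hψ m₀).eventually_nhds,
    (chartAt E m₀).open_source.mem_nhds (mem_chart_source E m₀)] with n hn hn'
  have hn2 : P.IsLiftAt c (ψ m₀) n := hn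
  ext x y
  refine (inCoordinates_bilinear_apply m₀ n hn' _ x y).trans ?_
  -- The lift chosen at `n` and the one chosen at `m₀` both compute `P.metric` at `n`, so the latter
  -- may replace the former.
  refine (((hψ n).metric_eq hP _ _).symm.trans (hn2.metric_eq hP _ _)).trans ?_
  simp only [Function.comp_apply, pullbackInner_apply, smul_apply,
    ContinuousLinearMap.comp_apply, inTangentCoordinates_apply, horizontalDeriv]
  rfl

/-- Differentiating `χ ∘ f = U ψ`, and using that horizontal components commute with `U`, matches
the representatives up to `U`, which preserves inner products. -/
theorem isInvariantUnder_of_isLiftAt {f : M → M} (U : unitary (H →L[ℂ] H)) (hP : P.HasJTangents)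
    (hf : MDifferentiable 𝓘(ℝ, E) 𝓘(ℝ, E) f)
    (h : ∀ m, ∃ ψ χ, P.IsLiftAt c ψ m ∧ P.IsLiftAt c χ (f m) ∧
      ∀ᶠ n in 𝓝 m, χ (f n) = (U : H →L[ℂ] H) (ψ n)) :
    P.IsInvariantUnder hP f := by
  intro m (x : E) (y : E)
  obtain ⟨ψ, χ, hψ, hχ, hU⟩ := h m
  let D : E →L[ℝ] E := mfderiv 𝓘(ℝ, E) 𝓘(ℝ, E) f m
  have key : ∀ x : E, horizontalDeriv c χ (f m) (D x) =
      (U : H →L[ℂ] H) (horizontalDeriv c ψ m x) := by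
    intro x
    have h1 : χ ∘ f =ᶠ[𝓝 m] ((U : H →L[ℂ] H).restrictScalars ℝ) ∘ ψ := hU
    have h2 := hχ.mdifferentiableAt.hasMFDerivAt.comp m (hf m).hasMFDerivAt
    have h3 := ((U : H →L[ℂ] H).restrictScalars ℝ).hasFDerivAt.hasMFDerivAt.comp m
      hψ.mdifferentiableAt.hasMFDerivAt
    have h4 := h2.mfderiv.symm.trans (h1.mfderiv_eq.trans h3.mfderiv)
    have h5 : modelDeriv χ (f m) (D x) =
      (U : H →L[ℂ] H) (modelDeriv ψ m x) := DFunLike.congr_fun h4 x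
    rw [horizontalDeriv_apply, horizontalDeriv_apply, (U : H →L[ℂ] H).map_smul_of_tower, ← horizontal_unitary, hU.self_of_nhds, h5]
  refine (hχ.metric_eq hP (D x) (D y)).trans (Eq.trans ?_ (hψ.metric_eq hP x y).symm)
  rw [key, key, Unitary.inner_map_map]

end ParametricModel

end Lifts

/-! ### Orbits of unitary representations -/

section Orbit

variable {H : Type*} [NormedAddCommGroup H] [InnerProductSpace ℂ H] [CompleteSpace H]
  {E : Type*} [NormedAddCommGroup E] [NormedSpace ℝ E]
  {M : Type*} [TopologicalSpace M] [ChartedSpace E M]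

/-- The parametric model `m ↦ |ψ m⟩⟨ψ m|`. -/
def vectorModel (ψ : M → H) (hψ : ContMDiff 𝓘(ℝ, E) 𝓘(ℝ, H) ∞ ψ) :
    ParametricModel E M (H →L[ℂ] H) where
  toFun m := rankOne (ψ m)
  smooth := contDiff_rankOne.comp_contMDiff hψ
  mem_nplf m := rankOne_mem_NPLF (ψ m)

theorem isLiftAt_vectorModel {ψ : M → H} (hψ : ContMDiff 𝓘(ℝ, E) 𝓘(ℝ, H) ∞ ψ) {c : ℝ}
    (hc : ∀ m, ‖ψ m‖ = c) (m : M) : (vectorModel ψ hψ).IsLiftAt c ψ m :=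
  Filter.Eventually.of_forall fun n => ⟨hψ n, hc n, rfl⟩

theorem apply_eq_of_coset_eq {G : Type*} [Group G] {π : G →* unitary (H →L[ℂ] H)} {φ : H}
    {g h : G} (hgh : (g : G ⧸ isotropy π φ) = h) :
    (π g : H →L[ℂ] H) φ = (π h : H →L[ℂ] H) φ := by
  have h1 : (π (g⁻¹ * h) : H →L[ℂ] H) φ = φ := QuotientGroup.eq.mp hgh
  conv_lhs => rw [← h1]
  rw [← mul_apply_eq_comp, ← Submonoid.coe_mul, ← map_mul, mul_inv_cancel_left]

theorem exists_orbit_model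
    {EG : Type*} [NormedAddCommGroup EG] [NormedSpace ℝ EG]
    {G : Type*} [TopologicalSpace G] [ChartedSpace EG G] [Group G] [LieGroup 𝓘(ℝ, EG) ∞ G]
    [IsManifold 𝓘(ℝ, E) ∞ M] (π : G →* unitary (H →L[ℂ] H)) (φ : H)
    (q : G ⧸ isotropy π φ ≃ M) (σ : M → G)
    (hφ : ContMDiff 𝓘(ℝ, EG) 𝓘(ℝ, H) ∞ (fun g : G => (π g : H →L[ℂ] H) φ))
    (hq : ContMDiff 𝓘(ℝ, EG) 𝓘(ℝ, E) ∞ (fun g : G => q (g : G ⧸ isotropy π φ)))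
    (hσ : ContMDiff 𝓘(ℝ, E) 𝓘(ℝ, EG) ∞ σ)
    (hqσ : ∀ m : M, q (σ m : G ⧸ isotropy π φ) = m) :
    ∃ P : ParametricModel E M (H →L[ℂ] H),
      (∀ m : M, P.toFun m = rankOne ((π (σ m) : H →L[ℂ] H) φ)) ∧
      ∃ hP : P.IsJRegular, ∀ g : G,
        ContMDiff 𝓘(ℝ, E) 𝓘(ℝ, E) ∞ (fun m : M => q (g • q.symm m)) ∧
        P.IsInvariantUnder hP.hasJTangents (fun m : M => q (g • q.symm m)) := by
  have hlift := isLiftAt_vectorModel (hφ.comp hσ) fun m => Unitary.norm_map (π (σ m)) φ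
  refine ⟨vectorModel _ (hφ.comp hσ), fun m => rfl,
    ParametricModel.isJRegular_of_isLiftAt fun m => ⟨_, hlift m⟩, fun g => ?_⟩
  have hsymm : ∀ m, q.symm m = (σ m : G ⧸ isotropy π φ) := fun m => by
    rw [Equiv.symm_apply_eq, hqσ]
  have hact : (fun m : M => q (g • q.symm m)) =
      fun m => q ((g * σ m : G) : G ⧸ isotropy π φ) := by
    funext m
    rw [hsymm]
    rfl
  have hsm : ContMDiff 𝓘(ℝ, E) 𝓘(ℝ, E) ∞ (fun m : M => q (g • q.symm m)) := by
    rw [hact]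
    exact hq.comp ((contMDiff_mul_left (a := g)).comp hσ)
  refine ⟨hsm, ParametricModel.isInvariantUnder_of_isLiftAt (π g) _
    (hsm.mdifferentiable (by simp)) fun m => ⟨_, _, hlift m, hlift _, ?_⟩⟩
  refine Filter.Eventually.of_forall fun n => ?_
  -- The section need not be equivariant, but both elements lie in one coset of the isotropy group,
  -- hence move `φ` to the same vector.
  have h1 : (σ (q (g • q.symm n)) : G ⧸ isotropy π φ) = (g * σ n : G) := by
    apply q.injective
    rw [hqσ]
    exact congrFun hact n
  have h2 := apply_eq_of_coset_eq h1
  rw [map_mul] at h2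
  exact h2

end Orbit

/-! ### Pure states attached to rays -/

section ProjectiveState

variable {H : Type u} [NormedAddCommGroup H] [InnerProductSpace ℂ H] [CompleteSpace H]

/-- The pure state of a ray, rescaled to have norm `c ^ 2`. -/
def projectiveState (c : ℝ) (p : ℙ ℂ H) : SADual (H →L[ℂ] H) :=
  (c / ‖p.rep‖) ^ 2 • rankOne p.rep

/-- Rescaling `v` by `a` multiplies `|v⟩⟨v|` by `|a|²`, which the normalisation cancels. -/
theorem projectiveState_mk (c : ℝ) (v : H) (hv : v ≠ 0) :
    projectiveState c (Projectivization.mk ℂ v hv) = (c / ‖v‖) ^ 2 • rankOne v := by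
  obtain ⟨a, ha⟩ := Projectivization.exists_smul_eq_mk_rep ℂ v hv
  have ha0 : ‖(a : ℂ)‖ ≠ 0 := norm_ne_zero_iff.mpr a.ne_zero
  have hv0 : ‖v‖ ≠ 0 := norm_ne_zero_iff.mpr hv
  rw [projectiveState, ← ha, Units.smul_def, rankOne_smul, smul_smul, norm_smul]
  congr 1
  field_simp

theorem unitary_apply_ne_zero (U : unitary (H →L[ℂ] H)) {v : H} (hv : v ≠ 0) :
    (U : H →L[ℂ] H) v ≠ 0 := by
  rwa [← norm_ne_zero_iff, Unitary.norm_map, norm_ne_zero_iff]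

theorem unitary_smul_mk (U : unitary (H →L[ℂ] H)) {v : H} (hv : v ≠ 0) :
    U • Projectivization.mk ℂ v hv =
      Projectivization.mk ℂ ((U : H →L[ℂ] H) v) (unitary_apply_ne_zero U hv) :=
  Projectivization.smul_mk U hv

end ProjectiveState

/-! ### Smooth normalisation of affine vectors -/

section AffineVector

variable {H : Type u} [NormedAddCommGroup H] [InnerProductSpace ℂ H] [Nontrivial H]

theorem norm_refVec_add_ne_zero (x : CPModel H) : ‖refVec H + (x : H)‖ ≠ 0 :=
  norm_ne_zero_iff.mpr (refVec_add_ne_zero x)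

theorem contDiff_refVec_add : ContDiff ℝ ∞ (fun x : CPModel H => refVec H + (x : H)) :=
  contDiff_const.add ((ℂ ∙ refVec H)ᗮ.subtypeL.restrictScalars ℝ).contDiff

theorem contDiff_div_norm_refVec_add (c : ℝ) :
    ContDiff ℝ ∞ (fun x : CPModel H => c / ‖refVec H + (x : H)‖) :=
  contDiff_const.div (contDiff_refVec_add.norm ℂ refVec_add_ne_zero) norm_refVec_add_ne_zero

end AffineVector

/-! ### The projective model, its unitary symmetry and definiteness -/

section ProjectiveModel

variable {H : Type u} [NormedAddCommGroup H] [InnerProductSpace ℂ H] [Nontrivial H]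
  [CompleteSpace H]

/-- The homeomorphism underlying the chart `uChart U`. -/
def uChartHomeomorph (U : unitary (H →L[ℂ] H)) : OpenPartialHomeomorph (ℙ ℂ H) (CPModel H) :=
  cpCore.openPartialHomeomorph (uChart U) ⟨U, rfl⟩

theorem uChartHomeomorph_mem_maximalAtlas (U : unitary (H →L[ℂ] H)) :
    uChartHomeomorph U ∈ IsManifold.maximalAtlas 𝓘(ℝ, CPModel H) ∞ (ℙ ℂ H) :=
  IsManifold.subset_maximalAtlas (Set.mem_iUnion₂.mpr ⟨uChart U, ⟨U, rfl⟩, rfl⟩)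

theorem isOpen_uChart_source (U : unitary (H →L[ℂ] H)) : IsOpen (uChart U).source :=
  (uChartHomeomorph U).open_source

theorem contMDiffAt_uChart (U : unitary (H →L[ℂ] H)) {p : ℙ ℂ H} (hp : p ∈ (uChart U).source) :
    ContMDiffAt 𝓘(ℝ, CPModel H) 𝓘(ℝ, CPModel H) ∞ (uChart U) p :=
  contMDiffAt_of_mem_maximalAtlas (uChartHomeomorph_mem_maximalAtlas U) hp

theorem contMDiff_uChart_symm (U : unitary (H →L[ℂ] H)) :
    ContMDiff 𝓘(ℝ, CPModel H) 𝓘(ℝ, CPModel H) ∞ (uChart U).symm := fun x =>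
  contMDiffAt_symm_of_mem_maximalAtlas (uChartHomeomorph_mem_maximalAtlas U)
    (show x ∈ (uChart U).target by rw [uChart_target]; trivial)

theorem uChart_symm_mul (U V : unitary (H →L[ℂ] H)) (x : CPModel H) :
    (uChart (U * V)).symm x = U • (uChart V).symm x := by
  rw [uChart_symm_apply, uChart_symm_apply, mul_smul]

theorem uChart_mul_smul (U V : unitary (H →L[ℂ] H)) (p : ℙ ℂ H) :
    uChart (U * V) (U • p) = uChart V p := by
  rw [uChart_apply, uChart_apply, mul_inv_rev, mul_smul, inv_smul_smul]

theorem smul_mem_uChart_source {U V : unitary (H →L[ℂ] H)} {p : ℙ ℂ H}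
    (hp : p ∈ (uChart V).source) : U • p ∈ (uChart (U * V)).source := by
  rw [uChart_source, Set.mem_ofPred_eq] at hp ⊢
  rwa [mul_inv_rev, mul_smul, inv_smul_smul]

/-- Read from the chart of `V` to the chart of `U * V`, the action of `U` is the identity. -/
theorem contMDiff_unitary_smul (U : unitary (H →L[ℂ] H)) :
    ContMDiff 𝓘(ℝ, CPModel H) 𝓘(ℝ, CPModel H) ∞ (fun p : ℙ ℂ H => U • p) := by
  intro p
  obtain ⟨V, hV⟩ := exists_mem_uChart p
  refine ((contMDiff_uChart_symm (U * V)).contMDiffAt.comp p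
    (contMDiffAt_uChart V hV)).congr_of_eventuallyEq ?_
  filter_upwards [(isOpen_uChart_source V).mem_nhds hV] with n hn
  rw [Function.comp_apply, uChart_symm_mul, (uChart V).left_inv hn]

/-- The lift of the affine chart transported by `U` to the sphere of radius `c`. -/
def affLift (c : ℝ) (U : unitary (H →L[ℂ] H)) (x : CPModel H) : H :=
  (c / ‖refVec H + (x : H)‖) • (U : H →L[ℂ] H) (refVec H + (x : H))

theorem contDiff_affLift (c : ℝ) (U : unitary (H →L[ℂ] H)) : ContDiff ℝ ∞ (affLift c U) :=
  (contDiff_div_norm_refVec_add c).fun_smul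
    (((U : H →L[ℂ] H).restrictScalars ℝ).contDiff.comp contDiff_refVec_add)

theorem norm_affLift {c : ℝ} (hc : 0 ≤ c) (U : unitary (H →L[ℂ] H)) (x : CPModel H) :
    ‖affLift c U x‖ = c := by
  rw [affLift, norm_smul, Unitary.norm_map, Real.norm_of_nonneg (by positivity),
    div_mul_cancel₀ _ (norm_refVec_add_ne_zero x)]

theorem projectiveState_uChart_symm (c : ℝ) (U : unitary (H →L[ℂ] H)) (x : CPModel H) :
    projectiveState c ((uChart U).symm x) = rankOne (affLift c U x) := by
  rw [uChart_symm_apply, unitary_smul_mk, projectiveState_mk, affLift, ← Complex.coe_smul, rankOne_smul, Unitary.norm_map,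
    Complex.norm_real, Real.norm_eq_abs, sq_abs]

theorem projectiveState_eq {c : ℝ} {U : unitary (H →L[ℂ] H)} {p : ℙ ℂ H}
    (hp : p ∈ (uChart U).source) : projectiveState c p = rankOne (affLift c U (uChart U p)) := by
  rw [← projectiveState_uChart_symm, (uChart U).left_inv hp]

theorem contMDiffAt_affLift_uChart (c : ℝ) {U : unitary (H →L[ℂ] H)} {p : ℙ ℂ H}
    (hp : p ∈ (uChart U).source) :
    ContMDiffAt 𝓘(ℝ, CPModel H) 𝓘(ℝ, H) ∞ (fun p => affLift c U (uChart U p)) p :=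
  (contDiff_affLift c U).contMDiff.contMDiffAt.comp p (contMDiffAt_uChart U hp)

/-- The parametric model of the pure states, rescaled to have norm `c ^ 2`. -/
def projectiveModel (c : ℝ) : ParametricModel (CPModel H) (ℙ ℂ H) (H →L[ℂ] H) where
  toFun := projectiveState c
  smooth p := by
    obtain ⟨U, hU⟩ := exists_mem_uChart p
    refine (contDiff_rankOne.contMDiff.contMDiffAt.comp p
      (contMDiffAt_affLift_uChart c hU)).congr_of_eventuallyEq ?_
    filter_upwards [(isOpen_uChart_source U).mem_nhds hU] with n hn
    exact projectiveState_eq hn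
  mem_nplf p := by
    obtain ⟨U, hU⟩ := exists_mem_uChart p
    rw [projectiveState_eq hU]
    exact rankOne_mem_NPLF _

theorem isLiftAt_projectiveModel {c : ℝ} (hc : 0 ≤ c) {U : unitary (H →L[ℂ] H)} {p : ℙ ℂ H}
    (hp : p ∈ (uChart U).source) :
    (projectiveModel c).IsLiftAt c (fun p => affLift c U (uChart U p)) p := by
  filter_upwards [(isOpen_uChart_source U).mem_nhds hp] with n hn
  exact ⟨contMDiffAt_affLift_uChart c hn, norm_affLift hc U _, projectiveState_eq hn⟩

theorem exists_isLiftAt_projectiveModel {c : ℝ} (hc : 0 ≤ c) (p : ℙ ℂ H) :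
    ∃ ψ, (projectiveModel c).IsLiftAt c ψ p := by
  obtain ⟨U, hU⟩ := exists_mem_uChart p
  exact ⟨_, isLiftAt_projectiveModel hc hU⟩

theorem isInvariantUnder_projectiveModel {c : ℝ} (hc : 0 ≤ c)
    (hP : (projectiveModel (H := H) c).HasJTangents) (U : unitary (H →L[ℂ] H)) :
    (projectiveModel c).IsInvariantUnder hP (fun p : ℙ ℂ H => U • p) := by
  refine ParametricModel.isInvariantUnder_of_isLiftAt (c := c) U hP
    ((contMDiff_unitary_smul U).mdifferentiable (by simp)) fun p => ?_
  obtain ⟨V, hV⟩ := exists_mem_uChart p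
  refine ⟨_, _, isLiftAt_projectiveModel hc hV,
    isLiftAt_projectiveModel hc (smul_mem_uChart_source hV), Filter.Eventually.of_forall fun n => ?_⟩
  -- The point `n` in chart `V` and `U • n` in chart `U * V` have the same coordinate, so the two
  -- lifts differ exactly by `U`.
  simp only [uChart_mul_smul]
  rw [affLift, affLift, (U : H →L[ℂ] H).map_smul_of_tower]
  rfl

theorem horizontal_fderiv_affLift_ne_zero {c : ℝ} (hc : 0 < c) (U : unitary (H →L[ℂ] H))
    (x ξ : CPModel H) (hξ : ξ ≠ 0) :
    horizontal c (affLift c U x) (fderiv ℝ (affLift c U) x ξ) ≠ 0 := by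
  intro h0
  let r : CPModel H → ℝ := fun x => c / ‖refVec H + (x : H)‖
  have hr : DifferentiableAt ℝ r x :=
    (contDiff_div_norm_refVec_add c).contDiffAt.differentiableAt (by simp)
  let L : CPModel H →L[ℝ] H :=
    ((U : H →L[ℂ] H).restrictScalars ℝ).comp ((ℂ ∙ refVec H)ᗮ.subtypeL.restrictScalars ℝ)
  have hL : HasFDerivAt (fun x : CPModel H => (U : H →L[ℂ] H) (refVec H + (x : H))) L x := by
    have := L.hasFDerivAt (x := x) |>.const_add ((U : H →L[ℂ] H) (refVec H))
    refine this.congr_of_eventuallyEq (Filter.Eventually.of_forall fun y => ?_)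
    exact map_add _ _ _
  have hD : fderiv ℝ (affLift c U) x ξ = r x • (U : H →L[ℂ] H) (ξ : H) +
      fderiv ℝ r x ξ • (U : H →L[ℂ] H) (refVec H + (x : H)) := by
    have := (hr.hasFDerivAt.fun_smul hL).fderiv
    exact DFunLike.congr_fun this ξ
  set s : ℝ := fderiv ℝ r x ξ
  have hrx : r x ≠ 0 := div_ne_zero hc.ne' (norm_refVec_add_ne_zero x)
  -- A vanishing horizontal component makes the derivative a pure phase rotation.
  obtain ⟨t, ht⟩ : ∃ t : ℝ, fderiv ℝ (affLift c U) x ξ = t • (Complex.I • affLift c U x) :=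
    ⟨_, sub_eq_zero.mp h0⟩
  rw [hD] at ht
  -- Pairing with `U e` eliminates `x` and `ξ`, both orthogonal to `e`. What remains equates the
  -- real number `s` with the imaginary number `t i r(x)`, so `s` and `t` both vanish.
  have h1 := congrArg (fun v => ⟪(U : H →L[ℂ] H) (refVec H), v⟫_ℂ) ht
  simp only [affLift, ← Complex.coe_smul, inner_add_right, inner_smul_right,
    Unitary.inner_map_map, inner_refVec_coe, inner_refVec_refVec] at h1
  have hs : s = 0 := by simpa using congrArg Complex.re h1
  have ht0 : t = 0 := by
    have h2 := congrArg Complex.im h1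
    simp only [hs] at h2
    simpa [hc.ne', norm_refVec_add_ne_zero x] using h2
  rw [hs, ht0, zero_smul, zero_smul, add_zero] at ht
  have h3 := (smul_eq_zero.mp ht).resolve_left hrx
  refine hξ (Subtype.ext (norm_eq_zero.mp ?_))
  rw [← Unitary.norm_map U, h3, norm_zero]

theorem metric_projectiveModel_pos {c : ℝ} (hc : 0 < c)
    (hP : (projectiveModel (H := H) c).HasJTangents) (p : ℙ ℂ H)
    (x : CPModel H) (hx : x ≠ 0) :
    0 < (projectiveModel c).metric hP p x x := by
  -- This is the unitary chosen in `cpCore`, so `uChart U` is by definition the preferred chart at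
  -- `p`; the derivative `D` is then invertible by the general result on `extChartAt`.
  let U := (exists_mem_uChart p).choose
  have hU : p ∈ (uChart U).source := (exists_mem_uChart p).choose_spec
  let ψ : ℙ ℂ H → H := fun p => affLift c U (uChart U p)
  rw [(isLiftAt_projectiveModel hc.le hU).metric_eq hP x x]
  let D : CPModel H →L[ℝ] CPModel H := mfderiv 𝓘(ℝ, CPModel H) 𝓘(ℝ, CPModel H) (uChart U) p
  have hDx : D x ≠ 0 := by
    have hi := isInvertible_mfderiv_extChartAt (I := 𝓘(ℝ, CPModel H)) (mem_extChartAt_source p)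
    have hinj : Function.Injective D := hi.injective
    exact fun h => hx (hinj (h.trans (map_zero D).symm))
  have hψ : modelDeriv ψ p x = fderiv ℝ (affLift c U) (uChart U p) (D x) := by
    have h1 := ((contDiff_affLift c U).differentiable (by simp)
      (uChart U p)).hasFDerivAt.hasMFDerivAt.comp p
        ((contMDiffAt_uChart U hU).mdifferentiableAt (by simp)).hasMFDerivAt
    exact DFunLike.congr_fun h1.mfderiv x
  have hne : horizontalDeriv c ψ p x ≠ 0 := by
    rw [horizontalDeriv_apply, hψ]
    exact smul_ne_zero two_ne_zero (horizontal_fderiv_affLift_ne_zero hc U _ _ hDx)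
  exact (re_inner_self_pos (𝕜 := ℂ)).mpr hne

theorem exists_projective_model (φ : H) (hφ : φ ≠ 0) :
    ∃ P : ParametricModel (CPModel H) (ℙ ℂ H) (H →L[ℂ] H),
      (∀ U : unitary (H →L[ℂ] H),
        P.toFun (U • Projectivization.mk ℂ φ hφ) = rankOne ((U : H →L[ℂ] H) φ)) ∧
      ∃ hP : P.IsJRegular,
        (∀ U : unitary (H →L[ℂ] H),
          ContMDiff 𝓘(ℝ, CPModel H) 𝓘(ℝ, CPModel H) ∞ (fun p : ℙ ℂ H => U • p) ∧
          P.IsInvariantUnder hP.hasJTangents (fun p : ℙ ℂ H => U • p)) ∧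
        ∀ (p : ℙ ℂ H) (x : TangentSpace 𝓘(ℝ, CPModel H) p), x ≠ 0 →
          0 < P.metric hP.hasJTangents p x x := by
  have hc : 0 < ‖φ‖ := norm_pos_iff.mpr hφ
  refine ⟨projectiveModel ‖φ‖, fun U => ?_,
    ParametricModel.isJRegular_of_isLiftAt (exists_isLiftAt_projectiveModel hc.le),
    fun U => ⟨contMDiff_unitary_smul U, isInvariantUnder_projectiveModel hc.le _ U⟩,
    metric_projectiveModel_pos hc _⟩
  change projectiveState _ _ = _
  rw [unitary_smul_mk, projectiveState_mk, Unitary.norm_map, div_self hc.ne', one_pow, one_smul]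

end ProjectiveModel

end

end JReg

theorem mainTheorem6
    {H : Type*} [NormedAddCommGroup H] [InnerProductSpace ℂ H] [CompleteSpace H] :
    (∀ (EG : Type*) [NormedAddCommGroup EG] [NormedSpace ℝ EG] [CompleteSpace EG]
      (G : Type*) [TopologicalSpace G] [ChartedSpace EG G] [Group G] [LieGroup 𝓘(ℝ, EG) ∞ G]
      (EM : Type*) [NormedAddCommGroup EM] [NormedSpace ℝ EM] [CompleteSpace EM]
      (M : Type*) [TopologicalSpace M] [ChartedSpace EM M] [IsManifold 𝓘(ℝ, EM) ∞ M]
      (π : G →* unitary (H →L[ℂ] H)) (φ : H)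
      (q : G ⧸ JReg.isotropy π φ ≃ M) (σ : M → G),
      (∀ ψ : H, Continuous fun g : G => (π g : H →L[ℂ] H) ψ) →
      ContMDiff 𝓘(ℝ, EG) 𝓘(ℝ, H) ∞ (fun g : G => (π g : H →L[ℂ] H) φ) →
      ContMDiff 𝓘(ℝ, EG) 𝓘(ℝ, EM) ∞ (fun g : G => q (g : G ⧸ JReg.isotropy π φ)) →
      ContMDiff 𝓘(ℝ, EM) 𝓘(ℝ, EG) ∞ σ →
      (∀ m : M, q (σ m : G ⧸ JReg.isotropy π φ) = m) →
      ∃ P : JReg.ParametricModel EM M (H →L[ℂ] H),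
        (∀ m : M, P.toFun m = JReg.rankOne ((π (σ m) : H →L[ℂ] H) φ)) ∧
        ∃ hP : P.IsJRegular, ∀ g : G,
          ContMDiff 𝓘(ℝ, EM) 𝓘(ℝ, EM) ∞ (fun m : M => q (g • q.symm m)) ∧
          P.IsInvariantUnder hP.hasJTangents (fun m : M => q (g • q.symm m))) ∧
    (∀ [Nontrivial H] (φ : H) (hφ : φ ≠ 0),
      ∃ P : JReg.ParametricModel (JReg.CPModel H) (ℙ ℂ H) (H →L[ℂ] H),
        (∀ U : unitary (H →L[ℂ] H),
          P.toFun (U • Projectivization.mk ℂ φ hφ) = JReg.rankOne ((U : H →L[ℂ] H) φ)) ∧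
        ∃ hP : P.IsJRegular,
          (∀ U : unitary (H →L[ℂ] H),
            ContMDiff 𝓘(ℝ, JReg.CPModel H) 𝓘(ℝ, JReg.CPModel H) ∞ (fun p : ℙ ℂ H => U • p) ∧
            P.IsInvariantUnder hP.hasJTangents (fun p : ℙ ℂ H => U • p)) ∧
          ∀ (p : ℙ ℂ H) (x : TangentSpace 𝓘(ℝ, JReg.CPModel H) p), x ≠ 0 →
            0 < P.metric hP.hasJTangents p x x) := by
  refine ⟨?_, fun φ hφ => JReg.exists_projective_model φ hφ⟩
  intro EG _ _ _ G _ _ _ _ EM _ _ _ M _ _ _ π φ q σ _ hφ hq hσ hqσ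
  exact JReg.exists_orbit_model π φ q σ hφ hq hσ hqσ
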